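/- Consider the $3$ user ADT deterministic interference network with $M$ parallel sub-channels: in sub-channel $m\in\{1,\dots,M\}$, when Transmitters $1,2,3$ send $X_1^{[m]},X_2^{[m]},X_3^{[m]}\in[0,1)$, Receiver $k$ observes $$Y_k^{[m]}=\lfloor 2^{n_{k1}^{[m]}}X_1^{[m]}\rfloor\oplus\lfloor 2^{n_{k2}^{[m]}}X_2^{[m]}\rfloor\oplus\lfloor 2^{n_{k3}^{[m]}}X_3^{[m]}\rfloor ,$$ where the $n_{ki}^{[m]}$ are nonnegative integers and $\oplus$ is bitwise addition modulo two. Transmitter $k$ has an independent, uniformly distributed message for Receiver $k$; coding may be joint over channel uses and sub-channels. The capacity region is the closure of the set of rate tuples $(R_1,R_2,R_3)$, $R_k\ge 0$, for which some sequence of codes with $\lceil 2^{NR_k}\rceil$ messages for user $k$ over $N$ channel uses has error probability tending to $0$ at every receiver as $N\to\infty$; the sum-capacity is the maximum of $R_1+R_2+R_3$ over the capacity region. Suppose that each sub-channel is TIN optimal, that is, $$n_{ii}^{[m]}\ \ge\ \max_{j\ne i}n_{ji}^{[m]}+\max_{k\ne i}n_{ik}^{[m]}\qquad\text{for all } i\in\{1,2,3\},\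 m\in\{1,\dots,M\},$$ and that $$n_{12}^{[m]}+n_{23}^{[m]}+n_{31}^{[m]}\ \ne\ n_{21}^{[m]}+n_{32}^{[m]}+n_{13}^{[m]}\qquad\text{for all } m\in\{1,\dots,M\}.$$ Then the sum-capacity of the network is achieved by a separate solution over each sub-channel that uses power control and treats interference as noise (TIN). That is, there are power back-offs $r_i^{[m]}\in\{0,1,2,\dots\}$ with the following property. In sub-channel $m$ let the first $r_i^{[m]}$ bits of the input of Transmitter $i$ be zero, let its further bits, up to the last one that reaches any receiver, be uniformly distributed, and let all these bits be independent; then the rates $R_k^{[m]}=I(X_k^{[m]};Y_k^{[m]})$ (in bits) form a rate tuple in the capacity region of sub-channel $m$ by itself, the tuple $\big(\sum_m R_k^{[m]}\big)_{k=1,2,3}$ is in the capacity region of the network, and $\sum_{k}\sum_m R_k^{[m]}$ is equal to the sum-capacity of the network. -/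

import Mathlib

open Filter Topology

noncomputable section

/-- One sub-channel of a `K` user ADT deterministic interference network: `n k i` is the channel
strength level `n_{ki}` from Transmitter `i` to Receiver `k`. -/
abbrev ADTSubchannel (K : ℕ) : Type := Fin K → Fin K → ℕ

/-- The channel inputs: reals `0.b₁b₂b₃…` in `[0, 1)`. -/
abbrev ADTInput : Type := Set.Ico (0 : ℝ) 1

namespace ADTSubchannel

variable {K : ℕ}

/-- The output of Receiver `k`, `⌊2 ^ n_{k1} X_1⌋ ⊕ ⋯ ⊕ ⌊2 ^ n_{kK} X_K⌋`,
where `⊕` (`^^^` on `ℕ`) is addition of binary expansions without carry. -/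
def output (n : ADTSubchannel K) (x : Fin K → ADTInput) (k : Fin K) : ℕ :=
  Finset.univ.fold (fun a b : ℕ => a ^^^ b) 0 (fun i => ⌊(2 : ℝ) ^ n k i * (x i : ℝ)⌋₊)

/-- The TIN optimality condition: `n_{ii} ≥ max_{j ≠ i} n_{ji} + max_{k ≠ i} n_{ik}` for all `i`
(a maximum over the empty set is `0`). -/
def TINOptimal (n : ADTSubchannel K) : Prop :=
  ∀ i, (Finset.univ.erase i).sup (fun j => n j i) + (Finset.univ.erase i).sup (fun k => n i k)
    ≤ n i i

/-- The number of leading bits of Transmitter `i` that reach some receiver. -/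
def depth (n : ADTSubchannel K) (i : Fin K) : ℕ := Finset.univ.sup (fun k => n k i)

/-- The sample space of the independent, uniformly distributed bits that the transmitters send
under the power back-off `r`: Transmitter `i` has the `depth i - r i` bits at the positions
`r i + 1, …, depth i` at its disposal (none, if `depth i ≤ r i`: it is then silent). -/
abbrev PowerControlled (n : ADTSubchannel K) (r : Fin K → ℕ) : Type :=
  ∀ i, Fin (2 ^ (n.depth i - r i))

/-- The input of Transmitter `i` under the power back-off `r`: the number `z / 2 ^ depth i`, whose
first `r i` bits are zero, so that it is less than `2 ^ (-r i)` (or is zero). -/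
def powerControlledInput (n : ADTSubchannel K) (r : Fin K → ℕ) (z : n.PowerControlled r)
    (i : Fin K) : ADTInput :=
  ⟨((z i : ℕ) : ℝ) / 2 ^ n.depth i, by positivity, by
    rw [div_lt_one (by positivity)]
    have h1 : (z i : ℕ) < 2 ^ n.depth i :=
      lt_of_lt_of_le (z i).isLt (Nat.pow_le_pow_right (by norm_num) (Nat.sub_le _ _))
    exact_mod_cast h1⟩

end ADTSubchannel

/-- The probability that `A = a`, for a function `A` of a uniformly distributed element of a
finite set. -/
def uniformProb {Ω α : Type*} [Fintype Ω] [DecidableEq α] (A : Ω → α) (a : α) : ℝ :=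
  ((Finset.univ.filter (fun ω => A ω = a)).card : ℝ) / Fintype.card Ω

/-- Shannon entropy, in bits, of a function of a uniformly distributed element of a finite set. -/
def uniformEntropy {Ω α : Type*} [Fintype Ω] [DecidableEq α] (A : Ω → α) : ℝ :=
  ∑ a ∈ Finset.univ.image A, Real.negMulLog (uniformProb A a) / Real.log 2

/-- Mutual information `I(A; B) = H(A) + H(B) - H(A, B)`, in bits. -/
def uniformMutualInfo {Ω α β : Type*} [Fintype Ω] [DecidableEq α] [DecidableEq β]
    (A : Ω → α) (B : Ω → β) : ℝ :=
  uniformEntropy A + uniformEntropy B - uniformEntropy (fun ω => (A ω, B ω))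

open scoped Classical in
/-- The rate `I(X_k; Y_k)` that user `k` obtains on a sub-channel when the transmitters use the
power back-offs `r` and Receiver `k` treats the interference as noise. -/
def ADTSubchannel.tinRate {K : ℕ} (n : ADTSubchannel K) (r : Fin K → ℕ) (k : Fin K) : ℝ :=
  uniformMutualInfo (fun z : n.PowerControlled r => n.powerControlledInput r z k)
    (fun z : n.PowerControlled r => n.output (n.powerControlledInput r z) k)

/-- A `K` user ADT deterministic interference network with `M` parallel sub-channels. -/
abbrev ADTNetwork (K M : ℕ) : Type := Fin M → ADTSubchannel K

namespace ADTNetwork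

variable {K M : ℕ}

/-- The sub-channel `m` as a network of its own, with a single sub-channel. -/
def single (n : ADTNetwork K M) (m : Fin M) : ADTNetwork K 1 := fun _ => n m

/-- A code over `N` channel uses for messages `W_k` in sets of `L k` elements. Coding may be joint
over time and over all the sub-channels. -/
structure Code (K M N : ℕ) (L : Fin K → ℕ) where
  /-- The codeword of Transmitter `i`: an input for each channel use and each sub-channel. -/
  enc : ∀ i : Fin K, Fin (L i) → Fin N → Fin M → ADTInput
  /-- The estimate of Receiver `k`, from its outputs in all channel uses and sub-channels. -/
  dec : ∀ k : Fin K, (Fin N → Fin M → ℕ) → Fin (L k)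

/-- What Receiver `k` observes when the messages are `w`. -/
def received (n : ADTNetwork K M) {N : ℕ} {L : Fin K → ℕ} (c : Code K M N L)
    (w : ∀ i, Fin (L i)) (k : Fin K) : Fin N → Fin M → ℕ :=
  fun t m => (n m).output (fun i => c.enc i (w i) t m) k

/-- The error probability of Receiver `k`, for independent, uniformly distributed messages. -/
def errorProb (n : ADTNetwork K M) {N : ℕ} {L : Fin K → ℕ} (c : Code K M N L) (k : Fin K) : ℝ :=
  ((Finset.univ.filter
      (fun w : ∀ i, Fin (L i) => c.dec k (n.received c w k) ≠ w k)).card : ℝ)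
    / Fintype.card (∀ i, Fin (L i))

/-- Achievable rate tuples: for message sets of `⌈2 ^ (N R_k)⌉` elements there are codes over `N`
channel uses whose error probabilities tend to `0` at every receiver as `N → ∞`. -/
def Achievable (n : ADTNetwork K M) (R : Fin K → ℝ) : Prop :=
  (∀ k, 0 ≤ R k) ∧
    ∃ c : ∀ N : ℕ, Code K M N (fun k => ⌈(2 : ℝ) ^ ((N : ℝ) * R k)⌉₊),
      ∀ k, Tendsto (fun N => n.errorProb (c N) k) atTop (𝓝 0)

/-- The capacity region: the closure of the set of achievable rate tuples. -/
def capacityRegion (n : ADTNetwork K M) : Set (Fin K → ℝ) := closure {R | n.Achievable R}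

/-- `S` is the sum-capacity: the maximum of `R_1 + ⋯ + R_K` over the capacity region. -/
def IsSumCapacity (n : ADTNetwork K M) (S : ℝ) : Prop :=
  IsGreatest ((fun R : Fin K → ℝ => ∑ k, R k) '' n.capacityRegion) S

/-- The rate tuple of a separate TIN solution with power back-offs `r m` in sub-channel `m`: the
users' TIN rates are added up over the sub-channels. -/
def separateTINRate (n : ADTNetwork K M) (r : Fin M → Fin K → ℕ) (k : Fin K) : ℝ :=
  ∑ m, (n m).tinRate (r m) k

end ADTNetwork

end

/-! In each sub-channel the loss against `∑ n_kk` is the weight of a heaviest cycle, either a pair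
`n_ij + n_ji` or one of the two oriented triples `n_ij + n_jk + n_ki`. The same weight bounds every
code and is attained by power control.

Converse. Fano's inequality gives, up to vanishing terms, `N R_k ≤ H(Y_k) - H(I_k)`, where `I_k` is
the interference at Receiver `k`. TIN optimality puts the bits `V_k` of Transmitter `k` that disturb
others (`d_k` of them, the `crossDepth`) above all interference at Receiver `k`, so `H(Y_k) ≤ H(V_k)
+ N (n_kk - d_k)` in each sub-channel's accounting. The `V_k` are independent, hence `∑ H(V_k)` is
their joint entropy. If the `I_k` together with the last `d_k - w_k` bits of each `V_k` determine
all `V_k` (`Invertible`), then `∑ H(V_k) ≤ ∑ H(I_k) + N ∑ (d_k - w_k)`; the `H(I_k)` cancel and `∑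
R_k ≤ ∑ (n_kk - w_k)`. The entropies are those of whole blocks, while invertibility is checked
sub-channel by sub-channel, so joint coding does not help and `w` may vary with the sub-channel.

Invertibility for `w` read off a pair is direct substitution. For a triple it is
`eq_zero_of_div_cycle`, which needs the triple to be strictly heavier than its reverse; this is
where the two triples being different enters.

Achievability. Back-offs `r` give the rates `n_kk - r_k - q_k`, with `q_k` the `noiseFloor`. A
heaviest cycle yields `r` with `∑ (r_k + q_k) = ∑ w_k`, which closes the gap. -/

/-! ### Entropy inequalities on a finite uniform space -/

section Entropy

variable {Ω α β : Type*} [Fintype Ω] [DecidableEq α] [DecidableEq β]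

lemma uniformProb_pos (A : Ω → α) (ω : Ω) : 0 < uniformProb A (A ω) := by
  have : 0 < (Finset.univ.filter (fun ω' => A ω' = A ω)).card :=
    Finset.card_pos.2 ⟨ω, by simp⟩
  have h2 : 0 < Fintype.card Ω := Fintype.card_pos_iff.2 ⟨ω⟩
  unfold uniformProb
  positivity

lemma sum_uniformProb_mul (A : Ω → α) (f : α → ℝ) :
    ∑ a ∈ Finset.univ.image A, uniformProb A a * f a = (∑ ω, f (A ω)) / Fintype.card Ω := by
  rw [Finset.sum_comp f A, Finset.sum_div]
  refine Finset.sum_congr rfl fun a _ => ?_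
  simp only [uniformProb, nsmul_eq_mul]
  ring

lemma sum_uniformProb_le_one (A : Ω → α) : ∑ a ∈ Finset.univ.image A, uniformProb A a ≤ 1 := by
  have := sum_uniformProb_mul A (fun _ => 1)
  simp only [mul_one, Finset.sum_const, Finset.card_univ, nsmul_eq_mul] at this
  rw [this]
  exact div_self_le_one _

lemma uniformEntropy_eq (A : Ω → α) :
    uniformEntropy A = (∑ ω, -Real.logb 2 (uniformProb A (A ω))) / Fintype.card Ω := by
  rw [← sum_uniformProb_mul A (fun a => -Real.logb 2 (uniformProb A a))]
  refine Finset.sum_congr rfl fun a _ => ?_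
  simp only [Real.negMulLog, Real.logb]
  ring

/-- Gibbs' inequality. -/
lemma uniformEntropy_le_of_subprob (A : Ω → α) (q : α → ℝ) (hq : ∀ ω, 0 < q (A ω))
    (hsum : ∑ a ∈ Finset.univ.image A, q a ≤ 1) :
    uniformEntropy A ≤ (∑ ω, -Real.logb 2 (q (A ω))) / Fintype.card Ω := by
  rcases isEmpty_or_nonempty Ω with h | h
  · simp [uniformEntropy_eq]
  have hc : (0 : ℝ) < Fintype.card Ω := by exact_mod_cast Fintype.card_pos
  have hl : 0 < Real.log 2 := Real.log_pos one_lt_two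
  have key : ∑ ω, q (A ω) / uniformProb A (A ω) ≤ Fintype.card Ω := by
    have := sum_uniformProb_mul A (fun a => q a / uniformProb A a)
    rw [eq_div_iff hc.ne'] at this
    rw [← this]
    have h2 : ∑ a ∈ Finset.univ.image A, uniformProb A a * (q a / uniformProb A a)
        = ∑ a ∈ Finset.univ.image A, q a := by
      refine Finset.sum_congr rfl fun a ha => ?_
      obtain ⟨ω, -, rfl⟩ := Finset.mem_image.1 ha
      exact mul_div_cancel₀ _ (uniformProb_pos A ω).ne'
    rw [h2]
    nlinarith
  rw [uniformEntropy_eq]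
  refine div_le_div_of_nonneg_right ?_ hc.le
  have step : ∀ ω, -Real.logb 2 (uniformProb A (A ω)) ≤
      -Real.logb 2 (q (A ω)) + (q (A ω) / uniformProb A (A ω) - 1) / Real.log 2 := by
    intro ω
    have h1 := Real.log_le_sub_one_of_pos (div_pos (hq ω) (uniformProb_pos A ω))
    rw [Real.log_div (hq ω).ne' (uniformProb_pos A ω).ne'] at h1
    have h2 := div_le_div_of_nonneg_right h1 hl.le
    rw [sub_div] at h2
    simp only [Real.logb]
    linarith
  calc _ ≤ _ := Finset.sum_le_sum fun ω _ => step ω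
    _ = ∑ ω, -Real.logb 2 (q (A ω))
        + (∑ ω, q (A ω) / uniformProb A (A ω) - Fintype.card Ω) / Real.log 2 := by
      rw [Finset.sum_add_distrib, ← Finset.sum_div, Finset.sum_sub_distrib]
      simp
    _ ≤ _ := by
      have := div_nonpos_of_nonpos_of_nonneg (sub_nonpos.2 key) hl.le
      linarith

/-- Each fibre of `B` lies inside a fibre of `A`, so the probabilities compare pointwise. -/
lemma uniformEntropy_mono (A : Ω → α) (B : Ω → β) (h : ∀ ω ω', B ω = B ω' → A ω = A ω') :
    uniformEntropy A ≤ uniformEntropy B := by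
  rw [uniformEntropy_eq, uniformEntropy_eq]
  refine div_le_div_of_nonneg_right (Finset.sum_le_sum fun ω _ => neg_le_neg ?_) (by positivity)
  refine Real.logb_le_logb_of_le one_lt_two (uniformProb_pos B ω) ?_
  unfold uniformProb
  gcongr with ω' _
  exact fun h' => h _ _ h'

lemma uniformEntropy_congr (A : Ω → α) (B : Ω → β) (h : ∀ ω ω', A ω = A ω' ↔ B ω = B ω') :
    uniformEntropy A = uniformEntropy B :=
  le_antisymm (uniformEntropy_mono A B fun ω ω' => (h ω ω').2)
    (uniformEntropy_mono B A fun ω ω' => (h ω ω').1)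

/-- Gibbs' inequality against the product of the marginals. -/
lemma uniformEntropy_prod_le (A : Ω → α) (B : Ω → β) :
    uniformEntropy (fun ω => (A ω, B ω)) ≤ uniformEntropy A + uniformEntropy B := by
  have hq : ∀ ω, 0 < uniformProb A (A ω) * uniformProb B (B ω) := fun ω =>
    mul_pos (uniformProb_pos A ω) (uniformProb_pos B ω)
  refine (uniformEntropy_le_of_subprob (fun ω => (A ω, B ω))
    (fun x => uniformProb A x.1 * uniformProb B x.2) hq ?_).trans (le_of_eq ?_)
  · have hsub : Finset.univ.image (fun ω => (A ω, B ω))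
        ⊆ Finset.univ.image A ×ˢ Finset.univ.image B := by
      intro x hx
      obtain ⟨ω, -, rfl⟩ := Finset.mem_image.1 hx
      simp
    have hn : ∀ (x : α × β), 0 ≤ uniformProb A x.1 * uniformProb B x.2 := fun x => by
      unfold uniformProb; positivity
    refine (Finset.sum_le_sum_of_subset_of_nonneg hsub fun x _ _ => hn x).trans ?_
    rw [Finset.sum_product, ← Finset.sum_mul_sum]
    have hB : 0 ≤ ∑ b ∈ Finset.univ.image B, uniformProb B b :=
      Finset.sum_nonneg fun b _ => by unfold uniformProb; positivity
    exact mul_le_one₀ (sum_uniformProb_le_one A) hB (sum_uniformProb_le_one B)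
  · rw [uniformEntropy_eq, uniformEntropy_eq, ← add_div, ← Finset.sum_add_distrib]
    congr 1
    refine Finset.sum_congr rfl fun ω _ => ?_
    rw [Real.logb_mul (uniformProb_pos A ω).ne' (uniformProb_pos B ω).ne']
    ring

lemma uniformEntropy_le_logb_card [Nonempty Ω] (A : Ω → α) (S : Finset α) (h : ∀ ω, A ω ∈ S) :
    uniformEntropy A ≤ Real.logb 2 S.card := by
  obtain ⟨ω₀⟩ := ‹Nonempty Ω›
  have hS : 0 < (S.card : ℝ) := by exact_mod_cast Finset.card_pos.2 ⟨_, h ω₀⟩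
  have hc : (Fintype.card Ω : ℝ) ≠ 0 := by
    have : Nonempty Ω := ⟨ω₀⟩
    exact_mod_cast Fintype.card_ne_zero
  refine (uniformEntropy_le_of_subprob A (fun _ => (S.card : ℝ)⁻¹) (fun _ => by positivity)
    ?_).trans (le_of_eq ?_)
  · have : Finset.univ.image A ⊆ S := by
      intro a ha
      obtain ⟨ω, -, rfl⟩ := Finset.mem_image.1 ha
      exact h ω
    have h2 : ((Finset.univ.image A).card : ℝ) ≤ S.card := by
      exact_mod_cast Finset.card_le_card this
    rw [Finset.sum_const, nsmul_eq_mul, ← div_eq_mul_inv]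
    exact div_le_one_of_le₀ h2 hS.le
  · simp only [Real.logb_inv, neg_neg, Finset.sum_const, Finset.card_univ, nsmul_eq_mul]
    field_simp

/-- A uniformly distributed random variable with `2 ^ c` values has `c` bits of entropy. -/
lemma uniformEntropy_eq_of_card_fiber [Nonempty Ω] (A : Ω → α) (c : ℕ)
    (h : ∀ ω, (Finset.univ.filter fun ω' => A ω' = A ω).card * 2 ^ c = Fintype.card Ω) :
    uniformEntropy A = c := by
  have hc : (Fintype.card Ω : ℝ) ≠ 0 := by exact_mod_cast Fintype.card_ne_zero
  have hp : ∀ ω, -Real.logb 2 (uniformProb A (A ω)) = c := by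
    intro ω
    have h1 : uniformProb A (A ω) = ((2 : ℝ) ^ c)⁻¹ := by
      have h2 : ((Finset.univ.filter fun ω' => A ω' = A ω).card : ℝ) * 2 ^ c
          = Fintype.card Ω := by exact_mod_cast h ω
      refine eq_inv_of_mul_eq_one_left ?_
      rw [uniformProb, div_mul_eq_mul_div, h2, div_self hc]
    rw [h1, Real.logb_inv, neg_neg, Real.logb_pow, Real.logb_self_eq_one one_lt_two, mul_one]
  rw [uniformEntropy_eq]
  simp only [hp, Finset.sum_const, Finset.card_univ, nsmul_eq_mul]
  field_simp

/-- Fano's inequality. -/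
lemma uniformEntropy_prod_le_fano [Nonempty Ω] {L : ℕ} (W : Ω → Fin L) (Y : Ω → β)
    (dec : β → Fin L) :
    uniformEntropy (fun ω => (Y ω, W ω)) ≤ uniformEntropy Y + 1 +
      ((Finset.univ.filter fun ω => dec (Y ω) ≠ W ω).card : ℝ) / Fintype.card Ω
        * Real.logb 2 L := by
  obtain ⟨ω₀⟩ := ‹Nonempty Ω›
  have hL : (0 : ℝ) < L := by exact_mod_cast (W ω₀).pos
  have hc : (Fintype.card Ω : ℝ) ≠ 0 := by
    have : Nonempty Ω := ⟨ω₀⟩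
    exact_mod_cast Fintype.card_ne_zero
  -- A correction for the decoder: silent when the guess is right, the true message otherwise. The
  -- pair `(Y, C)` determines `W`.
  let C : Ω → Option (Fin L) := fun ω => if dec (Y ω) = W ω then none else some (W ω)
  have h1 : uniformEntropy (fun ω => (Y ω, W ω)) ≤ uniformEntropy (fun ω => (Y ω, C ω)) := by
    refine uniformEntropy_mono _ _ fun ω ω' h => ?_
    simp only [Prod.mk.injEq, C] at h ⊢
    refine ⟨h.1, ?_⟩
    have h2 := h.2
    rw [← h.1] at h2
    split_ifs at h2 with h3 h4
    · rw [← h3, ← h4]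
    · exact Option.some.inj h2
  have h2 := uniformEntropy_prod_le Y C
  -- Half the mass on "no error" and half spread evenly over the messages: the cost is 1 bit, plus
  -- `logb 2 L` bits on an error.
  let q : Option (Fin L) → ℝ := fun o => o.elim (1 / 2) fun _ => 1 / 2 * (L : ℝ)⁻¹
  have h3 : uniformEntropy C ≤ (∑ ω, -Real.logb 2 (q (C ω))) / Fintype.card Ω := by
    refine uniformEntropy_le_of_subprob C q (fun ω => ?_) ?_
    · simp only [q]
      cases C ω <;> simp [hL]
    · refine (Finset.sum_le_sum_of_subset_of_nonneg (Finset.subset_univ _) fun o _ _ => ?_).trans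
        (le_of_eq ?_)
      · cases o <;> simp [q]
      · rw [Fintype.sum_option]
        simp only [q, Option.elim, Finset.sum_const, Finset.card_univ, Fintype.card_fin,
          nsmul_eq_mul]
        field_simp
        norm_num
  have h4 : ∀ ω, -Real.logb 2 (q (C ω))
      = 1 + (if dec (Y ω) ≠ W ω then Real.logb 2 L else 0) := by
    intro ω
    have h2' : Real.logb 2 (1 / 2) = -1 := by
      rw [one_div, Real.logb_inv, Real.logb_self_eq_one one_lt_two]
    by_cases h : dec (Y ω) = W ω
    · simp only [C, h, if_true, q, Option.elim, h2']
      simp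
    · simp only [C, h, if_false, q, Option.elim]
      rw [Real.logb_mul (by norm_num) (by positivity), h2', Real.logb_inv]
      simp only [ne_eq, h, not_false_eq_true, if_true]
      ring
  simp only [h4] at h3
  rw [Finset.sum_add_distrib, ← Finset.sum_filter] at h3
  simp only [Finset.sum_const, Finset.card_univ, nsmul_eq_mul, mul_one] at h3
  rw [add_div, div_self hc] at h3
  rw [div_mul_eq_mul_div]
  linarith

end Entropy

/-! ### Independence of functions of disjoint coordinates -/

section Independence

variable {ι : Type*} [Fintype ι] [DecidableEq ι] {Φ : ι → Type*} [∀ i, Fintype (Φ i)]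
  {α β : Type*} [DecidableEq α] [DecidableEq β]

/-- Functions of disjoint sets of coordinates are independent. -/
lemma card_fiber_prod (s : Finset ι) (A : (∀ i, Φ i) → α) (B : (∀ i, Φ i) → β)
    (hA : ∀ ω ω', (∀ i ∈ s, ω i = ω' i) → A ω = A ω')
    (hB : ∀ ω ω', (∀ i ∉ s, ω i = ω' i) → B ω = B ω') (a : α) (b : β) :
    (Finset.univ.filter fun ω => (A ω, B ω) = (a, b)).card * Fintype.card (∀ i, Φ i)
      = (Finset.univ.filter fun ω => A ω = a).card
        * (Finset.univ.filter fun ω => B ω = b).card := by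
  have e1 : ∀ ω ω' : ∀ i, Φ i, A (s.piecewise ω ω') = A ω := fun ω ω' =>
    hA _ _ fun i hi => by simp [hi]
  have e2 : ∀ ω ω' : ∀ i, Φ i, B (s.piecewise ω ω') = B ω' := fun ω ω' =>
    hB _ _ fun i hi => by simp [hi]
  have e3 : ∀ ω ω' : ∀ i, Φ i, s.piecewise (s.piecewise ω ω') (s.piecewise ω' ω) = ω := by
    intro ω ω'
    ext i
    by_cases hi : i ∈ s <;> simp [hi]
  rw [← Finset.card_univ, ← Finset.card_product, ← Finset.card_product]
  -- Exchanging the coordinates outside `s` between two points is an involution; it carries the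
  -- condition on `B` from the first point to the second and leaves the condition on `A`.
  refine Finset.card_nbij' (fun x => (s.piecewise x.1 x.2, s.piecewise x.2 x.1))
    (fun x => (s.piecewise x.1 x.2, s.piecewise x.2 x.1)) ?_ ?_ ?_ ?_
  · rintro ⟨x, y⟩ h
    simp only [Finset.coe_product, Set.mem_prod, Finset.mem_coe, Finset.mem_filter,
      Finset.mem_univ, true_and, Prod.mk.injEq, e1, e2] at h ⊢
    exact h.1
  · rintro ⟨x, y⟩ h
    simp only [Finset.coe_product, Set.mem_prod, Finset.mem_coe, Finset.mem_filter,
      Finset.mem_univ, true_and, and_true, Prod.mk.injEq, e1, e2] at h ⊢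
    exact h
  · rintro ⟨x, y⟩ _
    simp only [e3]
  · rintro ⟨x, y⟩ _
    simp only [e3]

lemma uniformEntropy_add_le_prod (s : Finset ι) (A : (∀ i, Φ i) → α) (B : (∀ i, Φ i) → β)
    (hA : ∀ ω ω', (∀ i ∈ s, ω i = ω' i) → A ω = A ω')
    (hB : ∀ ω ω', (∀ i ∉ s, ω i = ω' i) → B ω = B ω') :
    uniformEntropy A + uniformEntropy B ≤ uniformEntropy (fun ω => (A ω, B ω)) := by
  rw [uniformEntropy_eq, uniformEntropy_eq, uniformEntropy_eq, ← add_div,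
    ← Finset.sum_add_distrib]
  refine le_of_eq (congrArg (· / _) (Finset.sum_congr rfl fun ω _ => ?_))
  have hc : (Fintype.card (∀ i, Φ i) : ℝ) ≠ 0 := by
    have : Nonempty (∀ i, Φ i) := ⟨ω⟩
    exact_mod_cast Fintype.card_ne_zero
  have h : uniformProb (fun ω => (A ω, B ω)) (A ω, B ω)
      = uniformProb A (A ω) * uniformProb B (B ω) := by
    have h1 := card_fiber_prod s A B hA hB (A ω) (B ω)
    have h2 := congrArg (Nat.cast : ℕ → ℝ) h1
    push_cast at h2
    unfold uniformProb
    rw [div_mul_div_comm, ← h2]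
    field_simp
  rw [h, Real.logb_mul (uniformProb_pos A ω).ne' (uniformProb_pos B ω).ne']
  ring

end Independence

/-! ### Bit strings under XOR and the TIN rates -/

noncomputable section

lemma fold_xor_lt_two_pow {ι : Type*} (s : Finset ι) (f : ι → ℕ) (q : ℕ)
    (h : ∀ i ∈ s, f i < 2 ^ q) : s.fold (fun a b : ℕ => a ^^^ b) 0 f < 2 ^ q := by
  classical
  induction s using Finset.induction_on with
  | empty => simp
  | insert a s ha ih =>
    rw [Finset.fold_insert ha]
    exact Nat.xor_lt_two_pow (h a (Finset.mem_insert_self a s))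
      (ih fun i hi => h i (Finset.mem_insert_of_mem hi))

lemma fold_xor_eq_xor_erase {ι : Type*} [DecidableEq ι] (s : Finset ι) (f : ι → ℕ) {j : ι}
    (hj : j ∈ s) :
    s.fold (fun a b : ℕ => a ^^^ b) 0 f
      = f j ^^^ (s.erase j).fold (fun a b : ℕ => a ^^^ b) 0 f := by
  conv_lhs => rw [← Finset.insert_erase hj]
  exact Finset.fold_insert (Finset.notMem_erase j s)

/-- Adding a uniform bit string to an independent bit string that is no longer yields a uniform
bit string. -/
lemma card_fiber_xor_uniform {ι : Type*} [Fintype ι] [DecidableEq ι] {e : ι → ℕ} (j : ι) (s : ℕ)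
    (hs : s ≤ e j) (B g : (∀ i, Fin (2 ^ e i)) → ℕ)
    (hB : ∀ ω, B ω = (ω j : ℕ) / 2 ^ s ^^^ g ω)
    (hg : ∀ ω, g ω < 2 ^ (e j - s)) (hgj : ∀ ω c, g (Function.update ω j c) = g ω)
    (v : ℕ) (hv : v < 2 ^ (e j - s)) :
    (Finset.univ.filter fun ω => B ω = v).card * 2 ^ (e j - s)
      = Fintype.card (∀ i, Fin (2 ^ e i)) := by
  have hpow : 2 ^ (e j - s) * 2 ^ s = 2 ^ e j := by rw [← pow_add, Nat.sub_add_cancel hs]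
  have hBlt : ∀ ω, B ω < 2 ^ (e j - s) := fun ω => by
    rw [hB]
    refine Nat.xor_lt_two_pow ?_ (hg ω)
    rw [Nat.div_lt_iff_lt_mul (by positivity), hpow]
    exact (ω j).isLt
  have hshift : ∀ u < 2 ^ (e j - s), ∀ ω : ∀ i, Fin (2 ^ e i),
      (ω j : ℕ) ^^^ u * 2 ^ s < 2 ^ e j := fun u hu ω => by
    refine Nat.xor_lt_two_pow (ω j).isLt ?_
    rw [← hpow]
    exact Nat.mul_lt_mul_of_pos_right hu (by positivity)
  have heq : ∀ v' < 2 ^ (e j - s), (Finset.univ.filter fun ω => B ω = v').card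
      = (Finset.univ.filter fun ω => B ω = v).card := by
    intro v' hv'
    have hu : v' ^^^ v < 2 ^ (e j - s) := Nat.xor_lt_two_pow hv' hv
    -- Flipping bits of coordinate `j` above position `s` translates `B` by `v' ^^^ v`, so all level
    -- sets of `B` have the same size.
    let T : (∀ i, Fin (2 ^ e i)) → ∀ i, Fin (2 ^ e i) := fun ω =>
      Function.update ω j ⟨(ω j : ℕ) ^^^ (v' ^^^ v) * 2 ^ s, hshift _ hu ω⟩
    have hT : ∀ ω, B (T ω) = B ω ^^^ (v' ^^^ v) := fun ω => by
      rw [hB, hB, hgj]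
      simp only [T, Function.update_self, Nat.xor_div_two_pow]
      rw [Nat.mul_div_cancel _ (by positivity), Nat.xor_assoc, Nat.xor_comm (v' ^^^ v),
        Nat.xor_assoc]
    have hTT : ∀ ω, T (T ω) = ω := fun ω => by
      simp only [T, Function.update_self, Function.update_idem, Nat.xor_assoc, Nat.xor_self,
        Nat.xor_zero, Fin.eta, Function.update_eq_self]
    refine Finset.card_nbij' T T ?_ ?_ (fun ω _ => hTT ω) (fun ω _ => hTT ω)
    · intro ω h
      simp only [Finset.coe_filter, Finset.mem_univ, true_and, Set.mem_ofPred_eq, hT] at h ⊢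
      rw [h, ← Nat.xor_assoc, Nat.xor_self, Nat.zero_xor]
    · intro ω h
      simp only [Finset.coe_filter, Finset.mem_univ, true_and, Set.mem_ofPred_eq, hT] at h ⊢
      rw [h, Nat.xor_comm v', ← Nat.xor_assoc, Nat.xor_self, Nat.zero_xor]
  have hsum := Finset.card_eq_sum_card_fiberwise (s := Finset.univ)
    (t := Finset.range (2 ^ (e j - s))) (f := B) (fun ω _ => by simpa using hBlt ω)
  rw [Finset.sum_congr rfl fun v' hv' => heq v' (Finset.mem_range.1 hv')] at hsum
  rw [Finset.sum_const, Finset.card_range, smul_eq_mul, Finset.card_univ] at hsum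
  rw [hsum, mul_comm]

lemma floor_two_pow_mul_lt (n r : ℕ) {x : ℝ} (hx : x * 2 ^ r < 1) (h0 : 0 ≤ x) :
    ⌊(2 : ℝ) ^ n * x⌋₊ < 2 ^ (n - r) := by
  rw [Nat.floor_lt (by positivity)]
  push_cast
  rcases le_total r n with h | h
  · have : (2 : ℝ) ^ n = 2 ^ (n - r) * 2 ^ r := by rw [← pow_add, Nat.sub_add_cancel h]
    have h2 : (0 : ℝ) < 2 ^ (n - r) := by positivity
    rw [this]
    nlinarith
  · rw [Nat.sub_eq_zero_of_le h, pow_zero]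
    have : (2 : ℝ) ^ n ≤ 2 ^ r := pow_le_pow_right₀ one_le_two h
    nlinarith

lemma floor_two_pow_mul_div (n d z : ℕ) (h : n ≤ d) :
    ⌊(2 : ℝ) ^ n * ((z : ℝ) / 2 ^ d)⌋₊ = z / 2 ^ (d - n) := by
  have h1 : (2 : ℝ) ^ n * ((z : ℝ) / 2 ^ d) = (z : ℝ) / ((2 ^ (d - n) : ℕ) : ℝ) := by
    have : (2 : ℝ) ^ d = 2 ^ (d - n) * 2 ^ n := by rw [← pow_add, Nat.sub_add_cancel h]
    rw [this]
    push_cast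
    field_simp
  rw [h1, Nat.floor_div_eq_div]

namespace ADTSubchannel

variable {K : ℕ}

/-- What Receiver `k` would observe if Transmitter `k` were silent. -/
def interference (n : ADTSubchannel K) (x : Fin K → ADTInput) (k : Fin K) : ℕ :=
  (Finset.univ.erase k).fold (fun a b : ℕ => a ^^^ b) 0 (fun i => ⌊(2 : ℝ) ^ n k i * (x i : ℝ)⌋₊)

/-- The number of bit levels at Receiver `k` that see interference under the back-off `r`. -/
def noiseFloor (n : ADTSubchannel K) (r : Fin K → ℕ) (k : Fin K) : ℕ :=
  (Finset.univ.erase k).sup (fun j => n k j - r j)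

/-- The number of leading bits of Transmitter `i` that reach some undesired receiver. -/
def crossDepth (n : ADTSubchannel K) (i : Fin K) : ℕ :=
  (Finset.univ.erase i).sup (fun j => n j i)

lemma output_eq_xor_interference (n : ADTSubchannel K) (x : Fin K → ADTInput) (k : Fin K) :
    n.output x k = ⌊(2 : ℝ) ^ n k k * (x k : ℝ)⌋₊ ^^^ n.interference x k :=
  fold_xor_eq_xor_erase _ _ (Finset.mem_univ k)

lemma interference_lt (n : ADTSubchannel K) (x : Fin K → ADTInput) (k : Fin K) (q : ℕ)
    (h : ∀ j ≠ k, ⌊(2 : ℝ) ^ n k j * (x j : ℝ)⌋₊ < 2 ^ q) : n.interference x k < 2 ^ q :=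
  fold_xor_lt_two_pow _ _ _ fun i hi => h i (Finset.ne_of_mem_erase hi)

lemma interference_congr (n : ADTSubchannel K) (x x' : Fin K → ADTInput) (k : Fin K)
    (h : ∀ j ≠ k, x j = x' j) : n.interference x k = n.interference x' k :=
  Finset.fold_congr fun i hi => by rw [h i (Finset.ne_of_mem_erase hi)]

lemma interference_lt_noiseFloor (n : ADTSubchannel K) (x : Fin K → ADTInput) (r : Fin K → ℕ)
    (hx : ∀ i, (x i : ℝ) * 2 ^ r i < 1) (k : Fin K) :
    n.interference x k < 2 ^ n.noiseFloor r k := by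
  refine n.interference_lt x k _ fun j hj => ?_
  refine (floor_two_pow_mul_lt _ _ (hx j) (x j).2.1).trans_le (Nat.pow_le_pow_right two_pos ?_)
  exact Finset.le_sup (f := fun j => n k j - r j) (Finset.mem_erase.2 ⟨hj, Finset.mem_univ j⟩)

lemma le_depth (n : ADTSubchannel K) (k i : Fin K) : n k i ≤ n.depth i :=
  Finset.le_sup (f := fun k => n k i) (Finset.mem_univ k)

lemma le_crossDepth (n : ADTSubchannel K) {j i : Fin K} (h : j ≠ i) : n j i ≤ n.crossDepth i :=
  Finset.le_sup (f := fun j => n j i) (Finset.mem_erase.2 ⟨h, Finset.mem_univ j⟩)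

lemma TINOptimal.crossDepth_add_le {n : ADTSubchannel K} (h : n.TINOptimal) {i k : Fin K}
    (hk : k ≠ i) : n.crossDepth i + n i k ≤ n i i :=
  le_trans (Nat.add_le_add_left (Finset.le_sup (f := fun k => n i k)
    (Finset.mem_erase.2 ⟨hk, Finset.mem_univ k⟩)) _) (h i)

lemma TINOptimal.crossDepth_le {n : ADTSubchannel K} (h : n.TINOptimal) (i : Fin K) :
    n.crossDepth i ≤ n i i := le_trans (Nat.le_add_right _ _) (h i)

lemma TINOptimal.depth_eq {n : ADTSubchannel K} (h : n.TINOptimal) (i : Fin K) :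
    n.depth i = n i i := by
  refine le_antisymm (Finset.sup_le fun k _ => ?_) (n.le_depth i i)
  by_cases hk : k = i
  · rw [hk]
  · exact (n.le_crossDepth hk).trans (h.crossDepth_le i)

lemma floor_powerControlledInput (n : ADTSubchannel K) (r : Fin K → ℕ) (z : n.PowerControlled r)
    (k i : Fin K) :
    ⌊(2 : ℝ) ^ n k i * (n.powerControlledInput r z i : ℝ)⌋₊
      = (z i : ℕ) / 2 ^ (n.depth i - n k i) :=
  floor_two_pow_mul_div _ _ _ (n.le_depth k i)

lemma powerControlledInput_eq_iff (n : ADTSubchannel K) (r : Fin K → ℕ)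
    (z z' : n.PowerControlled r) (i : Fin K) :
    n.powerControlledInput r z i = n.powerControlledInput r z' i ↔ (z i : ℕ) = z' i := by
  rw [Subtype.ext_iff]
  change ((z i : ℕ) : ℝ) / _ = ((z' i : ℕ) : ℝ) / _ ↔ _
  rw [div_left_inj' (by positivity), Nat.cast_inj]

lemma powerControlledInput_mul_lt (n : ADTSubchannel K) (r : Fin K → ℕ) (i : Fin K)
    (hr : r i ≤ n.depth i) (z : n.PowerControlled r) :
    (n.powerControlledInput r z i : ℝ) * 2 ^ r i < 1 := by
  have h1 : ((z i : ℕ) : ℝ) < 2 ^ (n.depth i - r i) := by exact_mod_cast (z i).isLt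
  have h2 : (2 : ℝ) ^ n.depth i = 2 ^ (n.depth i - r i) * 2 ^ r i := by
    rw [← pow_add, Nat.sub_add_cancel hr]
  simp only [powerControlledInput]
  rw [div_mul_eq_mul_div, div_lt_one (by positivity), h2]
  exact mul_lt_mul_of_pos_right h1 (by positivity)

/-- The interferer that is received strongest after back-off already fills all `noiseFloor` levels
with uniform bits; the others are independent of it and no longer. -/
lemma uniformEntropy_interference (n : ADTSubchannel K) (r : Fin K → ℕ)
    (hr : ∀ i, r i ≤ n.depth i) (k : Fin K) :
    uniformEntropy (fun z : n.PowerControlled r =>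
      n.interference (n.powerControlledInput r z) k) = n.noiseFloor r k := by
  have hlt := fun z : n.PowerControlled r => n.interference_lt_noiseFloor
    (n.powerControlledInput r z) r (fun i => n.powerControlledInput_mul_lt r i (hr i) z) k
  refine uniformEntropy_eq_of_card_fiber _ _ fun ω => ?_
  rcases Nat.eq_zero_or_pos (n.noiseFloor r k) with h0 | h0
  · have hz : ∀ z, n.interference (n.powerControlledInput r z) k = 0 := fun z => by
      have := hlt z
      rw [h0, pow_zero] at this
      omega
    simp [hz, h0, Finset.card_univ]
  have hne : (Finset.univ.erase k).Nonempty := by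
    by_contra h
    rw [Finset.not_nonempty_iff_eq_empty] at h
    rw [noiseFloor, h] at h0
    simp at h0
  obtain ⟨j, hj, hjq⟩ := Finset.exists_mem_eq_sup _ hne (fun j => n k j - r j)
  have hq : n.noiseFloor r k = n k j - r j := hjq
  have hd := n.le_depth k j
  have hs : n.depth j - r j - (n.depth j - n k j) = n.noiseFloor r k := by omega
  have hlt' := hlt ω
  rw [← hs] at hlt' ⊢
  refine card_fiber_xor_uniform (e := fun i => n.depth i - r i) j (n.depth j - n k j)
    (by omega) _ (fun z => ((Finset.univ.erase k).erase j).fold (fun a b : ℕ => a ^^^ b) 0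
      (fun i => ⌊(2 : ℝ) ^ n k i * (n.powerControlledInput r z i : ℝ)⌋₊)) (fun z => ?_)
    (fun z => ?_) (fun z c => ?_) _ hlt'
  · rw [← floor_powerControlledInput]
    exact fold_xor_eq_xor_erase _ _ hj
  · refine fold_xor_lt_two_pow _ _ _ fun i hi => ?_
    rw [hs]
    refine (floor_two_pow_mul_lt _ _ (n.powerControlledInput_mul_lt r i (hr i) z)
      (n.powerControlledInput r z i).2.1).trans_le (Nat.pow_le_pow_right two_pos ?_)
    exact Finset.le_sup (f := fun j => n k j - r j) (Finset.mem_of_mem_erase hi)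
  · refine Finset.fold_congr fun i hi => ?_
    rw [floor_powerControlledInput, floor_powerControlledInput,
      Function.update_of_ne (Finset.ne_of_mem_erase hi)]

/-- Given the input, output and interference determine each other, so `H(X, Y) = H(X) + H(I)` and
the rate is `H(Y) - H(I)`. The output is uniform because the interference is no longer than the
desired signal. -/
lemma tinRate_eq (n : ADTSubchannel K) (r : Fin K → ℕ) (k : Fin K)
    (hr : ∀ i, r i ≤ n.depth i) (hd : n.depth k = n k k)
    (hk : r k + n.noiseFloor r k ≤ n k k) :
    n.tinRate r k = ((n k k - r k - n.noiseFloor r k : ℕ) : ℝ) := by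
  have hlt := fun z : n.PowerControlled r => n.interference_lt_noiseFloor
    (n.powerControlledInput r z) r (fun i => n.powerControlledInput_mul_lt r i (hr i) z) k
  have hz : uniformEntropy (fun z : n.PowerControlled r => (z k : ℕ))
      = ((n.depth k - r k : ℕ) : ℝ) := by
    refine uniformEntropy_eq_of_card_fiber _ _ fun ω => ?_
    exact card_fiber_xor_uniform (e := fun i => n.depth i - r i) k 0 (Nat.zero_le _)
      (fun z => (z k : ℕ)) (fun _ => 0) (fun z => by simp) (fun z => by positivity)
      (fun _ _ => rfl) _ (ω k).isLt
  have hout : ∀ z : n.PowerControlled r, n.output (n.powerControlledInput r z) k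
      = (z k : ℕ) / 2 ^ 0 ^^^ n.interference (n.powerControlledInput r z) k := fun z => by
    rw [output_eq_xor_interference, floor_powerControlledInput, Nat.sub_eq_zero_of_le hd.le]
  have hI : ∀ z : n.PowerControlled r, n.interference (n.powerControlledInput r z) k
      < 2 ^ (n.depth k - r k - 0) := fun z =>
    (hlt z).trans_le (Nat.pow_le_pow_right two_pos (by omega))
  have hupd : ∀ (z z' : n.PowerControlled r), (∀ j ≠ k, z j = z' j) →
      n.interference (n.powerControlledInput r z) k
        = n.interference (n.powerControlledInput r z') k := fun z z' h =>
    n.interference_congr _ _ _ fun j hj =>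
      (n.powerControlledInput_eq_iff r z z' j).2 (by rw [h j hj])
  have hY : uniformEntropy (fun z : n.PowerControlled r =>
      n.output (n.powerControlledInput r z) k) = ((n.depth k - r k : ℕ) : ℝ) := by
    refine uniformEntropy_eq_of_card_fiber _ _ fun ω => ?_
    refine card_fiber_xor_uniform (e := fun i => n.depth i - r i) k 0 (Nat.zero_le _)
      _ _ hout hI (fun z c => hupd _ _ fun j hj => Function.update_of_ne hj _ _) _ ?_
    rw [hout]
    refine Nat.xor_lt_two_pow ?_ (hI ω)
    simp
  have hXY : uniformEntropy (fun z : n.PowerControlled r =>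
      ((z k : ℕ), n.interference (n.powerControlledInput r z) k))
      = ((n.depth k - r k : ℕ) : ℝ) + n.noiseFloor r k := by
    rw [← hz, ← n.uniformEntropy_interference r hr k]
    refine le_antisymm (uniformEntropy_prod_le _ _) (uniformEntropy_add_le_prod {k} _ _ ?_ ?_)
    · intro ω ω' h
      rw [h k (Finset.mem_singleton_self k)]
    · intro ω ω' h
      exact hupd _ _ fun j hj => h j (by simpa using hj)
  have hpair : ∀ z z' : n.PowerControlled r,
      (n.powerControlledInput r z k, n.output (n.powerControlledInput r z) k)
        = (n.powerControlledInput r z' k, n.output (n.powerControlledInput r z') k) ↔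
      ((z k : ℕ), n.interference (n.powerControlledInput r z) k)
        = ((z' k : ℕ), n.interference (n.powerControlledInput r z') k) := fun z z' => by
    simp only [Prod.mk.injEq, powerControlledInput_eq_iff, hout]
    refine and_congr_right fun h => ?_
    rw [h]
    exact Nat.xor_right_inj
  rw [tinRate, uniformMutualInfo,
    uniformEntropy_congr _ _ fun z z' => n.powerControlledInput_eq_iff r z z' k,
    uniformEntropy_congr _ _ hpair, hz, hY, hXY, hd, Nat.sub_sub, Nat.cast_sub (by omega),
    Nat.cast_sub hk, Nat.cast_add]
  ring

end ADTSubchannel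

/-! ### Achievability by uncoded transmission -/

namespace ADTNetwork

variable {K M : ℕ}

/-- Uncoded transmission above the noise floor makes no errors. -/
lemma achievable_of_noiseFloor (n : ADTNetwork K M) (r : Fin M → Fin K → ℕ)
    (hr : ∀ m k, r m k + (n m).noiseFloor (r m) k ≤ n m k k) :
    n.Achievable fun k => ∑ m, ((n m k k - r m k - (n m).noiseFloor (r m) k : ℕ) : ℝ) := by
  set ρ : Fin M → Fin K → ℕ := fun m k => n m k k - r m k - (n m).noiseFloor (r m) k with hρ
  refine ⟨fun k => by positivity, ?_⟩
  -- The rates are integers, so the ceiling is exact and a message is just a block of bits.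
  have hcard : ∀ (N : ℕ) (k : Fin K), ⌈(2 : ℝ) ^ ((N : ℝ) * ∑ m, (ρ m k : ℝ))⌉₊
      = Fintype.card (Fin N → ∀ m, Fin (2 ^ ρ m k)) := fun N k => by
    have : (2 : ℝ) ^ ((N : ℝ) * ∑ m, (ρ m k : ℝ)) = ((2 ^ (N * ∑ m, ρ m k) : ℕ) : ℝ) := by
      push_cast
      rw [← Real.rpow_natCast]
      push_cast
      rfl
    rw [this, Nat.ceil_natCast]
    simp [Finset.prod_pow_eq_pow_sum, ← pow_mul, mul_comm]
  let E : ∀ (N : ℕ) (k : Fin K), Fin ⌈(2 : ℝ) ^ ((N : ℝ) * ∑ m, (ρ m k : ℝ))⌉₊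
      ≃ (Fin N → ∀ m, Fin (2 ^ ρ m k)) := fun N k =>
    (finCongr (hcard N k)).trans (Fintype.equivFin _).symm
  have hlt : ∀ m k (z : Fin (2 ^ ρ m k)),
      (((z : ℕ) * 2 ^ (n m).noiseFloor (r m) k : ℕ) : ℝ) / 2 ^ n m k k * 2 ^ r m k < 1 := by
    intro m k z
    rw [div_mul_eq_mul_div, div_lt_one (by positivity)]
    have h1 : n m k k = ρ m k + (n m).noiseFloor (r m) k + r m k := by
      have := hr m k
      simp only [hρ]
      omega
    rw [h1, pow_add, pow_add]
    push_cast
    have h2 : ((z : ℕ) : ℝ) < 2 ^ ρ m k := by exact_mod_cast z.isLt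
    gcongr
  -- Data bits sit between `r` leading zeros, which protect the other receivers, and `noiseFloor`
  -- zeros on the levels that see interference.
  let x : ∀ m k, Fin (2 ^ ρ m k) → ADTInput := fun m k z =>
    ⟨(((z : ℕ) * 2 ^ (n m).noiseFloor (r m) k : ℕ) : ℝ) / 2 ^ n m k k, by positivity, by
      refine lt_of_le_of_lt (le_mul_of_one_le_right (by positivity) ?_) (hlt m k z)
      exact one_le_pow₀ one_le_two⟩
  have hx : ∀ m (z : ∀ k, Fin (2 ^ ρ m k)) k,
      (n m).output (fun i => x m i (z i)) k / 2 ^ (n m).noiseFloor (r m) k = z k := by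
    intro m z k
    have hI := (n m).interference_lt_noiseFloor (fun i => x m i (z i)) (r m)
      (fun i => hlt m i (z i)) k
    rw [ADTSubchannel.output_eq_xor_interference, Nat.xor_div_two_pow, Nat.div_eq_of_lt hI,
      Nat.xor_zero]
    simp only [x]
    rw [floor_two_pow_mul_div _ _ _ le_rfl, Nat.sub_self, pow_zero, Nat.div_one,
      Nat.mul_div_cancel _ (by positivity)]
  refine ⟨fun N => ⟨fun i w t m => x m i (E N i w t m), fun k y => (E N k).symm fun t m =>
    ⟨y t m / 2 ^ (n m).noiseFloor (r m) k % 2 ^ ρ m k, Nat.mod_lt _ (by positivity)⟩⟩,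
    fun k => ?_⟩
  refine tendsto_const_nhds.congr fun N => ?_
  symm
  rw [errorProb, div_eq_zero_iff]
  left
  rw [Nat.cast_eq_zero, Finset.card_eq_zero, Finset.filter_eq_empty_iff]
  intro w _
  rw [not_not, Equiv.symm_apply_eq]
  funext t m
  apply Fin.ext
  simp only [received]
  rw [hx m (fun i => E N i (w i) t m) k]
  exact Nat.mod_eq_of_lt (E N k (w k) t m).isLt

lemma separateTINRate_mem_capacityRegion (n : ADTNetwork K M) (hn : ∀ m, (n m).TINOptimal)
    (r : Fin M → Fin K → ℕ) (hr : ∀ m k, r m k + (n m).noiseFloor (r m) k ≤ n m k k) :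
    n.separateTINRate r ∈ n.capacityRegion := by
  refine subset_closure ?_
  have h : n.separateTINRate r
      = fun k => ∑ m, ((n m k k - r m k - (n m).noiseFloor (r m) k : ℕ) : ℝ) := by
    funext k
    refine Finset.sum_congr rfl fun m _ => ADTSubchannel.tinRate_eq _ _ _ (fun i => ?_)
      ((hn m).depth_eq k) (hr m k)
    rw [(hn m).depth_eq i]
    exact (Nat.le_add_right _ _).trans (hr m i)
  rw [Set.mem_ofPred_eq, h]
  exact n.achievable_of_noiseFloor r hr

end ADTNetwork

end

/-! ### Recovering the interfering bits from the interference -/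

noncomputable section

lemma eq_zero_of_mod_of_div {u a : ℕ} (h : u % 2 ^ a = 0) (hd : u / 2 ^ a = 0) : u = 0 := by
  rw [← Nat.div_add_mod u (2 ^ a), h, hd, mul_zero]

/-- Around a cycle of bit strings that are shifted copies of each other, with a total shift that
is nonzero, everything vanishes. -/
lemma eq_zero_of_div_cycle {u₁ u₂ u₃ a₁ a₂ a₃ b₁ b₂ b₃ : ℕ} (h₁ : u₁ % 2 ^ a₁ = 0)
    (h₂ : u₂ % 2 ^ a₂ = 0) (h₃ : u₃ % 2 ^ a₃ = 0) (h₁₂ : u₁ / 2 ^ a₁ = u₂ / 2 ^ b₂)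
    (h₂₃ : u₂ / 2 ^ a₂ = u₃ / 2 ^ b₃) (h₃₁ : u₃ / 2 ^ a₃ = u₁ / 2 ^ b₁)
    (h : a₁ + a₂ + a₃ < b₁ + b₂ + b₃) : u₁ = 0 ∧ u₂ = 0 ∧ u₃ = 0 := by
  -- With `t = u / 2 ^ a` and `t' = v / 2 ^ a'` this reads `t * 2 ^ b ≤ 2 ^ a' * t'`. Multiplied
  -- around the cycle, the quotients cancel unless one of them vanishes.
  have key : ∀ {u v a b a' : ℕ}, v % 2 ^ a' = 0 → u / 2 ^ a = v / 2 ^ b →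
      (u / 2 ^ a) * 2 ^ b ≤ 2 ^ a' * (v / 2 ^ a') := by
    intro u v a b a' hv huv
    rw [huv]
    refine (Nat.div_mul_le_self v (2 ^ b)).trans (le_of_eq ?_)
    have := Nat.div_add_mod v (2 ^ a')
    omega
  have k₁ := key h₂ h₁₂
  have k₂ := key h₃ h₂₃
  have k₃ := key h₁ h₃₁
  -- A zero propagates backwards around the cycle.
  have hz : ∀ {u v a b : ℕ}, u % 2 ^ a = 0 → u / 2 ^ a = v / 2 ^ b → v = 0 → u = 0 :=
    fun hu huv hv => eq_zero_of_mod_of_div hu (by rw [huv, hv, Nat.zero_div])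
  have hprod : (u₁ / 2 ^ a₁) * (u₂ / 2 ^ a₂) * (u₃ / 2 ^ a₃) = 0 := by
    by_contra hne
    have hpos := Nat.pos_of_ne_zero hne
    have hmul := Nat.mul_le_mul (Nat.mul_le_mul k₁ k₂) k₃
    have hle : (u₁ / 2 ^ a₁) * (u₂ / 2 ^ a₂) * (u₃ / 2 ^ a₃) * 2 ^ (b₁ + b₂ + b₃)
        ≤ (u₁ / 2 ^ a₁) * (u₂ / 2 ^ a₂) * (u₃ / 2 ^ a₃) * 2 ^ (a₁ + a₂ + a₃) := by
      rw [pow_add, pow_add, pow_add, pow_add]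
      calc _ = _ := by ring
        _ ≤ _ := hmul
        _ = _ := by ring
    exact absurd (Nat.le_of_mul_le_mul_left hle hpos)
      (not_le.2 (Nat.pow_lt_pow_right one_lt_two h))
  rcases Nat.mul_eq_zero.1 hprod with h' | h'
  · rcases Nat.mul_eq_zero.1 h' with h' | h'
    · have e₁ := eq_zero_of_mod_of_div h₁ h'
      have e₃ := hz h₃ h₃₁ e₁
      exact ⟨e₁, hz h₂ h₂₃ e₃, e₃⟩
    · have e₂ := eq_zero_of_mod_of_div h₂ h'
      have e₁ := hz h₁ h₁₂ e₂
      exact ⟨e₁, e₂, hz h₃ h₃₁ e₁⟩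
  · have e₃ := eq_zero_of_mod_of_div h₃ h'
    have e₂ := hz h₂ h₂₃ e₃
    exact ⟨hz h₁ h₁₂ e₂, e₂, e₃⟩

lemma floor_two_pow_mul_of_le (x : ℝ) {n d : ℕ} (h : n ≤ d) :
    ⌊(2 : ℝ) ^ n * x⌋₊ = ⌊(2 : ℝ) ^ d * x⌋₊ / 2 ^ (d - n) := by
  have h1 : (2 : ℝ) ^ n * x = (2 : ℝ) ^ d * x / ((2 ^ (d - n) : ℕ) : ℝ) := by
    have : (2 : ℝ) ^ d = 2 ^ (d - n) * 2 ^ n := by rw [← pow_add, Nat.sub_add_cancel h]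
    rw [this]
    push_cast
    field_simp
  rw [h1, Nat.floor_div_natCast]

lemma floor_two_pow_mul_input_lt (n : ℕ) (x : ADTInput) : ⌊(2 : ℝ) ^ n * (x : ℝ)⌋₊ < 2 ^ n := by
  simpa using floor_two_pow_mul_lt n 0 (x := (x : ℝ)) (by simpa using x.2.2) x.2.1

namespace ADTSubchannel

variable {K : ℕ}

/-- The leading bits of Transmitter `k` that reach some undesired receiver. -/
def crossInput (n : ADTSubchannel K) (x : Fin K → ADTInput) (k : Fin K) : ℕ :=
  ⌊(2 : ℝ) ^ n.crossDepth k * (x k : ℝ)⌋₊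

/-- The interference at all receivers determines the leading `w k` bits of each Transmitter `k`,
once the further bits that cause interference are given. -/
def Invertible (n : ADTSubchannel K) (w : Fin K → ℕ) : Prop :=
  ∀ x x' : Fin K → ADTInput, (∀ k, n.interference x k = n.interference x' k) →
    (∀ k, n.crossInput x k % 2 ^ (n.crossDepth k - w k)
      = n.crossInput x' k % 2 ^ (n.crossDepth k - w k)) →
    ∀ k, n.crossInput x k = n.crossInput x' k

lemma crossInput_lt (n : ADTSubchannel K) (x : Fin K → ADTInput) (k : Fin K) :
    n.crossInput x k < 2 ^ n.crossDepth k := floor_two_pow_mul_input_lt _ _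

/-- The bits that cause interference are received above all interference. -/
lemma TINOptimal.output_div {n : ADTSubchannel K} (h : n.TINOptimal) (x : Fin K → ADTInput)
    (k : Fin K) : n.output x k / 2 ^ (n k k - n.crossDepth k) = n.crossInput x k := by
  have hI : n.interference x k < 2 ^ (n k k - n.crossDepth k) := by
    refine n.interference_lt x k _ fun j hj => ?_
    refine (floor_two_pow_mul_input_lt _ _).trans_le (Nat.pow_le_pow_right two_pos ?_)
    have := h.crossDepth_add_le hj
    omega
  rw [output_eq_xor_interference, Nat.xor_div_two_pow, Nat.div_eq_of_lt hI, Nat.xor_zero,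
    crossInput, floor_two_pow_mul_of_le (x k : ℝ) (h.crossDepth_le k)]

lemma interference_fin_three (n : ADTSubchannel 3) (x : Fin 3 → ADTInput) {i j k : Fin 3}
    (hij : i ≠ j) (hik : i ≠ k) (hjk : j ≠ k) :
    n.interference x k
      = n.crossInput x i / 2 ^ (n.crossDepth i - n k i)
        ^^^ n.crossInput x j / 2 ^ (n.crossDepth j - n k j) := by
  have he : (Finset.univ.erase k).erase i = {j} := by
    revert i j k
    decide
  rw [interference, fold_xor_eq_xor_erase _ _ (Finset.mem_erase.2 ⟨hik, Finset.mem_univ i⟩), he,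
    Finset.fold_singleton, Nat.xor_zero, crossInput, crossInput,
    floor_two_pow_mul_of_le (x i : ℝ) (n.le_crossDepth hik.symm),
    floor_two_pow_mul_of_le (x j : ℝ) (n.le_crossDepth hjk.symm)]

/-- Invertibility only concerns the differences of two inputs. -/
lemma invertible_of_differences (n : ADTSubchannel 3) (w : Fin 3 → ℕ)
    (h : ∀ u : Fin 3 → ℕ, (∀ k, u k < 2 ^ n.crossDepth k) →
      (∀ i j k, i ≠ j → i ≠ k → j ≠ k →
        u i / 2 ^ (n.crossDepth i - n k i) = u j / 2 ^ (n.crossDepth j - n k j)) →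
      (∀ k, u k % 2 ^ (n.crossDepth k - w k) = 0) → ∀ k, u k = 0) : n.Invertible w := by
  intro x x' hI hr k
  rw [← Nat.xor_eq_zero_iff]
  refine h (fun k => n.crossInput x k ^^^ n.crossInput x' k) (fun k => ?_) ?_ (fun k => ?_) k
  · exact Nat.xor_lt_two_pow (n.crossInput_lt x k) (n.crossInput_lt x' k)
  · intro i j k hij hik hjk
    have := hI k
    rw [n.interference_fin_three x hij hik hjk, n.interference_fin_three x' hij hik hjk] at this
    simp only [Nat.xor_div_two_pow]
    rw [← Nat.xor_eq_zero_iff] at this ⊢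
    rw [← this]
    ac_rfl
  · simp only [Nat.xor_mod_two_pow, hr k, Nat.xor_self]

lemma fin_three_cases {i j k : Fin 3} (hij : i ≠ j) (hik : i ≠ k) (hjk : j ≠ k) (a : Fin 3) :
    a = i ∨ a = j ∨ a = k := by
  revert i j k a
  decide

/-- All interfering bits of `k` are given. Removing them at Receiver `j` exposes the top `n j i`
bits of `i`, and at Receiver `i` the top `n i j` bits of `j`. -/
lemma invertible_of_two_cycle (n : ADTSubchannel 3) {i j k : Fin 3} (hij : i ≠ j) (hik : i ≠ k)
    (hjk : j ≠ k) (w : Fin 3 → ℕ) (hi : w i = n j i) (hj : w j = n i j) (hk : w k = 0) :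
    n.Invertible w := by
  refine n.invertible_of_differences w fun u hlt hI hr => ?_
  have ek : u k = 0 := by
    have := hr k
    rwa [hk, Nat.sub_zero, Nat.mod_eq_of_lt (hlt k)] at this
  have ei : u i = 0 := by
    have h1 := hr i
    rw [hi] at h1
    refine eq_zero_of_mod_of_div h1 ?_
    rw [hI i k j hik hij hjk.symm, ek, Nat.zero_div]
  have ej : u j = 0 := by
    have h1 := hr j
    rw [hj] at h1
    refine eq_zero_of_mod_of_div h1 ?_
    rw [hI j k i hjk hij.symm hik.symm, ek, Nat.zero_div]
  intro a
  rcases fin_three_cases hij hik hjk a with rfl | rfl | rfl <;> assumption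

/-- Zero difference in the interference equates, at each receiver, the received parts of the two
interferers. The three equations form a cycle whose total shift is the weight difference of the two
triples, nonzero by `h`. -/
lemma invertible_of_three_cycle (n : ADTSubchannel 3) {i j k : Fin 3} (hij : i ≠ j) (hik : i ≠ k)
    (hjk : j ≠ k) (w : Fin 3 → ℕ) (hi : w i = n k i) (hj : w j = n i j) (hk : w k = n j k)
    (h : n j i + n k j + n i k < n i j + n j k + n k i) : n.Invertible w := by
  refine n.invertible_of_differences w fun u _ hI hr => ?_
  have h1 := hr i
  have h2 := hr j
  have h3 := hr k
  rw [hi] at h1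
  rw [hj] at h2
  rw [hk] at h3
  have b1 := n.le_crossDepth hij.symm
  have b2 := n.le_crossDepth hik.symm
  have b3 := n.le_crossDepth hij
  have b4 := n.le_crossDepth hjk.symm
  have b5 := n.le_crossDepth hik
  have b6 := n.le_crossDepth hjk
  obtain ⟨e1, e2, e3⟩ := eq_zero_of_div_cycle h1 h2 h3 (hI i j k hij hik hjk)
    (hI j k i hjk hij.symm hik.symm) (hI k i j hik.symm hjk.symm hij) (by omega)
  intro a
  rcases fin_three_cases hij hik hjk a with rfl | rfl | rfl <;> assumption

end ADTSubchannel

/-! ### The converse -/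

lemma uniformEntropy_apply {K : ℕ} (L : Fin K → ℕ) (k : Fin K) [Nonempty (∀ i, Fin (L i))] :
    uniformEntropy (fun ω : ∀ i, Fin (L i) => ω k) = Real.logb 2 (L k) := by
  have hc : (Fintype.card (∀ i, Fin (L i)) : ℝ) ≠ 0 := by exact_mod_cast Fintype.card_ne_zero
  have hcard : ∀ a : Fin (L k), (Finset.univ.filter fun ω : ∀ i, Fin (L i) => ω k = a).card * L k
      = Fintype.card (∀ i, Fin (L i)) := by
    intro a
    suffices h : ((Finset.univ.filter fun ω : ∀ i, Fin (L i) => ω k = a) ×ˢ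
        (Finset.univ : Finset (Fin (L k)))).card = (Finset.univ : Finset (∀ i, Fin (L i))).card by
      rwa [Finset.card_product, Finset.card_univ, Finset.card_univ, Fintype.card_fin] at h
    refine Finset.card_nbij' (fun p => Function.update p.1 k p.2)
      (fun ω => (Function.update ω k a, ω k)) ?_ ?_ ?_ ?_
    · intro p _
      simp
    · intro ω _
      simp
    · rintro ⟨ω, b⟩ h
      have h' : ω k = a := by simpa using h
      simp [← h']
    · intro ω _
      simp
  have hp : ∀ ω : ∀ i, Fin (L i),
      -Real.logb 2 (uniformProb (fun ω : ∀ i, Fin (L i) => ω k) (ω k)) = Real.logb 2 (L k) := by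
    intro ω
    have h1 : uniformProb (fun ω : ∀ i, Fin (L i) => ω k) (ω k) = (L k : ℝ)⁻¹ := by
      refine eq_inv_of_mul_eq_one_left ?_
      have := congrArg (Nat.cast : ℕ → ℝ) (hcard (ω k))
      push_cast at this hc
      rw [uniformProb, div_mul_eq_mul_div, this]
      exact div_self hc
    rw [h1, Real.logb_inv, neg_neg]
  rw [uniformEntropy_eq]
  simp only [hp, Finset.sum_const, Finset.card_univ, nsmul_eq_mul]
  field_simp

lemma uniformEntropy_blocks_le {Ω : Type*} [Fintype Ω] [Nonempty Ω] {N M : ℕ}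
    (A : Ω → Fin N → Fin M → ℕ) (b : Fin M → ℕ) (h : ∀ ω t m, A ω t m < 2 ^ b m) :
    uniformEntropy A ≤ N * ∑ m, (b m : ℝ) := by
  refine (uniformEntropy_le_logb_card A
    (Fintype.piFinset fun _ => Fintype.piFinset fun m => Finset.range (2 ^ b m))
    fun ω => ?_).trans (le_of_eq ?_)
  · simpa using h ω
  · simp only [Fintype.card_piFinset, Finset.card_range, Finset.prod_pow_eq_pow_sum]
    push_cast
    rw [Real.logb_pow, Real.logb_self_eq_one one_lt_two]
    simp

namespace ADTNetwork

variable {K M : ℕ}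

/-- Given `W_k`, output and interference determine each other, so `H(Y_k, W_k) = H(I_k, W_k)`.
Independence bounds this below by `H(I_k) + H(W_k)`, Fano's inequality above. -/
lemma logb_card_le (n : ADTNetwork K M) {N : ℕ} {L : Fin K → ℕ} [Nonempty (∀ i, Fin (L i))]
    (c : Code K M N L) (k : Fin K) :
    (1 - n.errorProb c k) * Real.logb 2 (L k)
      ≤ uniformEntropy (fun ω => n.received c ω k) + 1
        - uniformEntropy (fun (ω : ∀ i, Fin (L i)) (t : Fin N) (m : Fin M) =>
            (n m).interference (fun i => c.enc i (ω i) t m) k) := by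
  have h1 := uniformEntropy_add_le_prod {k}ᶜ (fun (ω : ∀ i, Fin (L i)) (t : Fin N) (m : Fin M) =>
    (n m).interference (fun i => c.enc i (ω i) t m) k) (fun ω => ω k)
    (fun ω ω' h => by
      funext t m
      exact (n m).interference_congr _ _ _ fun j hj => by rw [h j (by simpa using hj)])
    (fun ω ω' h => h k (by simp))
  rw [uniformEntropy_apply] at h1
  have h2 := uniformEntropy_congr
    (fun ω : ∀ i, Fin (L i) => ((fun (t : Fin N) (m : Fin M) =>
      (n m).interference (fun i => c.enc i (ω i) t m) k), ω k))
    (fun ω => (n.received c ω k, ω k)) fun ω ω' => by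
      simp only [Prod.mk.injEq]
      refine and_congr_left fun h => ?_
      simp only [funext_iff, received, ADTSubchannel.output_eq_xor_interference, h,
        Nat.xor_right_inj]
  have h3 := uniformEntropy_prod_le_fano (fun ω : ∀ i, Fin (L i) => ω k)
    (fun ω => n.received c ω k) (c.dec k)
  rw [errorProb]
  linarith

/-- By `output_div` the top bits of the output are exactly the interfering bits; the levels below
are merely counted. -/
lemma uniformEntropy_received_le (n : ADTNetwork K M) (hn : ∀ m, (n m).TINOptimal) {N : ℕ}
    {L : Fin K → ℕ} [Nonempty (∀ i, Fin (L i))] (c : Code K M N L) (k : Fin K) :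
    uniformEntropy (fun ω => n.received c ω k)
      ≤ uniformEntropy (fun (ω : ∀ i, Fin (L i)) (t : Fin N) (m : Fin M) =>
          (n m).crossInput (fun i => c.enc i (ω i) t m) k)
        + N * ∑ m, ((n m k k - (n m).crossDepth k : ℕ) : ℝ) := by
  let low : (∀ i, Fin (L i)) → Fin N → Fin M → ℕ := fun ω t m =>
    n.received c ω k t m % 2 ^ (n m k k - (n m).crossDepth k)
  have hlow := uniformEntropy_blocks_le low _ fun ω t m => Nat.mod_lt _ (by positivity)
  refine le_trans ?_ (add_le_add_right hlow _)
  refine le_trans ?_ (uniformEntropy_prod_le _ _)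
  refine uniformEntropy_mono _ _ fun ω ω' h => ?_
  simp only [Prod.mk.injEq, funext_iff, low] at h
  funext t m
  have h1 := h.1 t m
  have h2 := h.2 t m
  rw [← (hn m).output_div, ← (hn m).output_div] at h1
  rw [← Nat.div_add_mod (n.received c ω k t m) (2 ^ (n m k k - (n m).crossDepth k)), h2]
  conv_rhs =>
    rw [← Nat.div_add_mod (n.received c ω' k t m) (2 ^ (n m k k - (n m).crossDepth k))]
  simp only [received] at h1 ⊢
  rw [h1]

set_option synthInstance.maxSize 512 in
-- The heart of the converse: independence turns the left side into one joint entropy, and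
-- invertibility bounds that by interference plus residual bits `B`.
lemma uniformEntropy_crossInput_le (n : ADTNetwork 3 M) (w : Fin M → Fin 3 → ℕ)
    (hinv : ∀ m, (n m).Invertible (w m)) {N : ℕ}
    {L : Fin 3 → ℕ} [Nonempty (∀ i, Fin (L i))] (c : Code 3 M N L) :
    ∑ k, uniformEntropy (fun (ω : ∀ i, Fin (L i)) (t : Fin N) (m : Fin M) =>
        (n m).crossInput (fun i => c.enc i (ω i) t m) k)
      ≤ ∑ k, (uniformEntropy (fun (ω : ∀ i, Fin (L i)) (t : Fin N) (m : Fin M) =>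
          (n m).interference (fun i => c.enc i (ω i) t m) k)
        + N * ∑ m, (((n m).crossDepth k - w m k : ℕ) : ℝ)) := by
  set V : Fin 3 → (∀ i, Fin (L i)) → Fin N → Fin M → ℕ := fun k ω t m =>
    (n m).crossInput (fun i => c.enc i (ω i) t m) k with hV
  set I : Fin 3 → (∀ i, Fin (L i)) → Fin N → Fin M → ℕ := fun k ω t m =>
    (n m).interference (fun i => c.enc i (ω i) t m) k with hI
  let B : Fin 3 → (∀ i, Fin (L i)) → Fin N → Fin M → ℕ := fun k ω t m =>
    V k ω t m % 2 ^ ((n m).crossDepth k - w m k)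
  have hB : ∀ k, uniformEntropy (B k) ≤ N * ∑ m, (((n m).crossDepth k - w m k : ℕ) : ℝ) :=
    fun k => uniformEntropy_blocks_le (B k) _ fun ω t m => Nat.mod_lt _ (by positivity)
  have hVk : ∀ k (ω ω' : ∀ i, Fin (L i)), ω k = ω' k → V k ω = V k ω' := fun k ω ω' h => by
    funext t m
    simp only [hV, ADTSubchannel.crossInput, h]
  have hV12 := uniformEntropy_add_le_prod {1} (V 1) (V 2)
    (fun ω ω' h => hVk _ _ _ (h 1 (by simp))) (fun ω ω' h => hVk _ _ _ (h 2 (by simp)))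
  have hV012 := uniformEntropy_add_le_prod {0} (V 0) (fun ω => (V 1 ω, V 2 ω))
    (fun ω ω' h => hVk _ _ _ (h 0 (by simp)))
    (fun ω ω' h => by rw [hVk 1 _ _ (h 1 (by simp)), hVk 2 _ _ (h 2 (by simp))])
  have hmono := uniformEntropy_mono (fun ω => (V 0 ω, (V 1 ω, V 2 ω)))
    (fun ω => ((I 0 ω, B 0 ω), ((I 1 ω, B 1 ω), (I 2 ω, B 2 ω)))) fun ω ω' h => by
      simp only [Prod.mk.injEq, funext_iff] at h
      obtain ⟨⟨i0, b0⟩, ⟨i1, b1⟩, ⟨i2, b2⟩⟩ := h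
      have : ∀ t m k, V k ω t m = V k ω' t m := fun t m =>
        hinv m _ _ (by simpa [Fin.forall_fin_succ] using ⟨i0 t m, i1 t m, i2 t m⟩)
          (by simpa [Fin.forall_fin_succ] using ⟨b0 t m, b1 t m, b2 t m⟩)
      simp only [Prod.mk.injEq, funext_iff]
      exact ⟨fun t m => this t m 0, fun t m => this t m 1, fun t m => this t m 2⟩
  have h0 := uniformEntropy_prod_le (I 0) (B 0)
  have h1 := uniformEntropy_prod_le (I 1) (B 1)
  have h2 := uniformEntropy_prod_le (I 2) (B 2)
  have h12 := uniformEntropy_prod_le (fun ω => (I 1 ω, B 1 ω)) (fun ω => (I 2 ω, B 2 ω))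
  have h012 := uniformEntropy_prod_le (fun ω => (I 0 ω, B 0 ω))
    (fun ω => ((I 1 ω, B 1 ω), (I 2 ω, B 2 ω)))
  rw [Fin.sum_univ_three, Fin.sum_univ_three]
  linarith [hB 0, hB 1, hB 2]

/-- The interference entropies cancel in the sum over the users; each user contributes 1 to the
constant 3 through Fano's inequality. -/
lemma sum_logb_card_le (n : ADTNetwork 3 M) (hn : ∀ m, (n m).TINOptimal) (w : Fin M → Fin 3 → ℕ)
    (hw : ∀ m k, w m k ≤ (n m).crossDepth k) (hinv : ∀ m, (n m).Invertible (w m)) {N : ℕ}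
    {L : Fin 3 → ℕ} [Nonempty (∀ i, Fin (L i))] (c : Code 3 M N L) :
    ∑ k, (1 - n.errorProb c k) * Real.logb 2 (L k)
      ≤ N * ∑ k, ∑ m, ((n m k k - w m k : ℕ) : ℝ) + 3 := by
  have h1 := fun k => n.logb_card_le c k
  have h2 := fun k => n.uniformEntropy_received_le hn c k
  have h3 := n.uniformEntropy_crossInput_le w hinv c
  have h4 : ∀ k, ∑ m, ((n m k k - w m k : ℕ) : ℝ)
      = ∑ m, ((n m k k - (n m).crossDepth k : ℕ) : ℝ)
        + ∑ m, (((n m).crossDepth k - w m k : ℕ) : ℝ) := fun k => by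
    rw [← Finset.sum_add_distrib]
    refine Finset.sum_congr rfl fun m _ => ?_
    have := (hn m).crossDepth_le k
    have := hw m k
    rw [← Nat.cast_add]
    congr 1
    omega
  rw [Fin.sum_univ_three] at h3 ⊢
  rw [Fin.sum_univ_three] at h3 ⊢
  rw [h4, h4, h4]
  linarith [h1 0, h1 1, h1 2, h2 0, h2 1, h2 2]

lemma sum_le_of_achievable (n : ADTNetwork 3 M) (hn : ∀ m, (n m).TINOptimal)
    (w : Fin M → Fin 3 → ℕ) (hw : ∀ m k, w m k ≤ (n m).crossDepth k)
    (hinv : ∀ m, (n m).Invertible (w m)) {R : Fin 3 → ℝ} (hR : n.Achievable R) :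
    ∑ k, R k ≤ ∑ k, ∑ m, ((n m k k - w m k : ℕ) : ℝ) := by
  obtain ⟨-, c, hc⟩ := hR
  set S := ∑ k, ∑ m, ((n m k k - w m k : ℕ) : ℝ)
  have hlim1 : Tendsto (fun N => ∑ k, (1 - n.errorProb (c N) k) * R k) atTop (𝓝 (∑ k, R k)) := by
    refine tendsto_finsetSum _ fun k _ => ?_
    simpa using ((tendsto_const_nhds (x := (1 : ℝ))).sub (hc k)).mul_const (R k)
  have hlim2 : Tendsto (fun N : ℕ => S + 3 / (N : ℝ)) atTop (𝓝 S) := by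
    simpa using (tendsto_const_nhds (x := S)).add (tendsto_const_div_atTop_nhds_zero_nat (3 : ℝ))
  refine le_of_tendsto_of_tendsto hlim1 hlim2 ?_
  filter_upwards [eventually_gt_atTop 0] with N hN
  have hN' : (0 : ℝ) < N := by exact_mod_cast hN
  have hL : ∀ k, 0 < ⌈(2 : ℝ) ^ ((N : ℝ) * R k)⌉₊ := fun k => Nat.ceil_pos.2 (by positivity)
  have : Nonempty (∀ k, Fin ⌈(2 : ℝ) ^ ((N : ℝ) * R k)⌉₊) := ⟨fun k => ⟨0, hL k⟩⟩
  have h := n.sum_logb_card_le hn w hw hinv (c N)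
  have hP : ∀ k, 0 ≤ 1 - n.errorProb (c N) k := fun k => by
    rw [sub_nonneg, errorProb]
    refine div_le_one_of_le₀ ?_ (by positivity)
    exact_mod_cast Finset.card_le_univ _
  have hlog : ∀ k, (N : ℝ) * R k ≤ Real.logb 2 ⌈(2 : ℝ) ^ ((N : ℝ) * R k)⌉₊ := fun k => by
    rw [Real.le_logb_iff_rpow_le one_lt_two (by exact_mod_cast hL k)]
    exact Nat.le_ceil _
  have h2 : ∑ k, (1 - n.errorProb (c N) k) * ((N : ℝ) * R k) ≤ N * S + 3 :=
    (Finset.sum_le_sum fun k _ => mul_le_mul_of_nonneg_left (hlog k) (hP k)).trans h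
  have h3 : ∑ k, (1 - n.errorProb (c N) k) * ((N : ℝ) * R k)
      = N * ∑ k, (1 - n.errorProb (c N) k) * R k := by
    rw [Finset.mul_sum]
    exact Finset.sum_congr rfl fun k _ => by ring
  rw [h3] at h2
  have h4 : (N : ℝ) * (S + 3 / N) = N * S + 3 := by field_simp
  exact le_of_mul_le_mul_left (h2.trans h4.ge) hN'

end ADTNetwork

end

/-! ### Optimal back-offs from a heaviest cycle -/

namespace ADTSubchannel

lemma noiseFloor_fin_three (n : ADTSubchannel 3) (r : Fin 3 → ℕ) {i j k : Fin 3} (hij : i ≠ j)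
    (hik : i ≠ k) (hjk : j ≠ k) : n.noiseFloor r k = max (n k i - r i) (n k j - r j) := by
  have he : Finset.univ.erase k = {i, j} := by
    revert i j k
    decide
  rw [noiseFloor, he, Finset.sup_insert, Finset.sup_singleton]

lemma crossDepth_fin_three (n : ADTSubchannel 3) {i j k : Fin 3} (hij : i ≠ j)
    (hik : i ≠ k) (hjk : j ≠ k) : n.crossDepth k = max (n i k) (n j k) := by
  have he : Finset.univ.erase k = {i, j} := by
    revert i j k
    decide
  rw [crossDepth, he, Finset.sup_insert, Finset.sup_singleton]

lemma sum_fin_three_of_distinct (f : Fin 3 → ℕ) {i j k : Fin 3} (hij : i ≠ j) (hik : i ≠ k)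
    (hjk : j ≠ k) : ∑ a, f a = f i + f j + f k := by
  have he : Finset.univ = ({i, j, k} : Finset (Fin 3)) := by
    revert i j k
    decide
  rw [he, Finset.sum_insert (by simp [hij, hik]), Finset.sum_insert (by simp [hjk]),
    Finset.sum_singleton, add_assoc]

lemma forall_fin_three_of_distinct {p : Fin 3 → Prop} {i j k : Fin 3} (hij : i ≠ j) (hik : i ≠ k)
    (hjk : j ≠ k) (hi : p i) (hj : p j) (hk : p k) : ∀ a, p a := fun a => by
  rcases fin_three_cases hij hik hjk a with rfl | rfl | rfl <;> assumption

/-- Power back-offs `r` whose rates are optimal, as certified by an invertible choice `w` of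
interfering bits. -/
def HasOptimalBackoff (n : ADTSubchannel 3) : Prop :=
  ∃ r w : Fin 3 → ℕ, (∀ k, w k ≤ n.crossDepth k) ∧ n.Invertible w ∧
    (∀ k, r k + n.noiseFloor r k ≤ n k k) ∧ ∑ k, (r k + n.noiseFloor r k) = ∑ k, w k

/-- TIN optimality makes the rates nonnegative as soon as `r k` is at most `crossDepth k`, since the
noise floor is at most the strongest incoming cross link. -/
lemma TINOptimal.hasOptimalBackoff_of {n : ADTSubchannel 3} (hn : n.TINOptimal) {i j k : Fin 3}
    (hij : i ≠ j) (hik : i ≠ k) (hjk : j ≠ k) (w r : Fin 3 → ℕ) (hinv : n.Invertible w)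
    (hwi : w i ≤ max (n j i) (n k i)) (hwj : w j ≤ max (n i j) (n k j))
    (hwk : w k ≤ max (n i k) (n j k))
    (hri : r i ≤ max (n j i) (n k i)) (hrj : r j ≤ max (n i j) (n k j))
    (hrk : r k ≤ max (n i k) (n j k))
    (hsum : r i + max (n i j - r j) (n i k - r k) + (r j + max (n j i - r i) (n j k - r k))
      + (r k + max (n k i - r i) (n k j - r j)) = w i + w j + w k) :
    n.HasOptimalBackoff := by
  have qi := n.noiseFloor_fin_three r hjk hij.symm hik.symm
  have qj := n.noiseFloor_fin_three r hik hij hjk.symm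
  have qk := n.noiseFloor_fin_three r hij hik hjk
  have pi := n.crossDepth_fin_three hjk hij.symm hik.symm
  have pj := n.crossDepth_fin_three hik hij hjk.symm
  have pk := n.crossDepth_fin_three hij hik hjk
  have tij := hn.crossDepth_add_le hij.symm
  have tik := hn.crossDepth_add_le hik.symm
  have tji := hn.crossDepth_add_le hij
  have tjk := hn.crossDepth_add_le hjk.symm
  have tki := hn.crossDepth_add_le hik
  have tkj := hn.crossDepth_add_le hjk
  refine ⟨r, w, forall_fin_three_of_distinct hij hik hjk (by omega) (by omega) (by omega), hinv,
    forall_fin_three_of_distinct hij hik hjk (by omega) (by omega) (by omega), ?_⟩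
  rw [sum_fin_three_of_distinct _ hij hik hjk, sum_fin_three_of_distinct _ hij hik hjk, qi, qj, qk,
    hsum]

/-- The hypotheses amount to `n j k + n k i ≤ n j i` and `n k j + n i k ≤ n i j`, so the pair also
outweighs the other two pairs. -/
lemma TINOptimal.hasOptimalBackoff_of_two_cycle {n : ADTSubchannel 3} (hn : n.TINOptimal)
    {i j k : Fin 3} (hij : i ≠ j) (hik : i ≠ k) (hjk : j ≠ k)
    (h₁ : n i j + n j k + n k i ≤ n i j + n j i) (h₂ : n j i + n k j + n i k ≤ n i j + n j i) :
    n.HasOptimalBackoff := by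
  obtain ⟨w, wi, wj, wk⟩ : ∃ w : Fin 3 → ℕ, w i = n j i ∧ w j = n i j ∧ w k = 0 :=
    ⟨fun a => if a = i then n j i else if a = j then n i j else 0,
      by simp, by simp [hij.symm], by simp [hik.symm, hjk.symm]⟩
  -- Users `i` and `j` back off until Receiver `k` sees no interference. The noise floors at `i` and
  -- `j` are then `n i j - n k j` and `n j i - n k i`, and the back-offs cancel.
  obtain ⟨r, ri, rj, rk⟩ : ∃ r : Fin 3 → ℕ, r i = n k i ∧ r j = n k j ∧ r k = 0 :=
    ⟨fun a => if a = i then n k i else if a = j then n k j else 0,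
      by simp, by simp [hij.symm], by simp [hik.symm, hjk.symm]⟩
  exact hn.hasOptimalBackoff_of hij hik hjk w r
    (n.invertible_of_two_cycle hij hik hjk w wi wj wk) (by omega) (by omega) (by omega)
    (by omega) (by omega) (by omega) (by omega)

lemma TINOptimal.hasOptimalBackoff_of_three_cycle {n : ADTSubchannel 3} (hn : n.TINOptimal)
    {i j k : Fin 3} (hij : i ≠ j) (hik : i ≠ k) (hjk : j ≠ k)
    (h : n j i + n k j + n i k < n i j + n j k + n k i)
    (h₁ : n i j + n j i ≤ n i j + n j k + n k i) (h₂ : n j k + n k j ≤ n i j + n j k + n k i)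
    (h₃ : n i k + n k i ≤ n i j + n j k + n k i) : n.HasOptimalBackoff := by
  obtain ⟨w, wi, wj, wk⟩ : ∃ w : Fin 3 → ℕ, w i = n k i ∧ w j = n i j ∧ w k = n j k :=
    ⟨fun a => if a = i then n k i else if a = j then n i j else n j k,
      by simp, by simp [hij.symm], by simp [hik.symm, hjk.symm]⟩
  -- The aim is that the links of the triple set every noise floor, as in `n i j - r j ≥ n i k - r
  -- k`. These are difference constraints, and this is their least nonnegative solution, a longest
  -- path of at most two steps; truncated subtraction supplies the maxima with 0. Going once around
  -- has negative length by `h`.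
  obtain ⟨r, ri, rj, rk⟩ : ∃ r : Fin 3 → ℕ, r i = n j i + (n i k - n i j) - n j k ∧
      r j = n k j + (n j i - n j k) - n k i ∧ r k = n i k + (n k j - n k i) - n i j :=
    ⟨fun a => if a = i then n j i + (n i k - n i j) - n j k else
      if a = j then n k j + (n j i - n j k) - n k i else n i k + (n k j - n k i) - n i j,
      by simp, by simp [hij.symm], by simp [hik.symm, hjk.symm]⟩
  exact hn.hasOptimalBackoff_of hij hik hjk w r
    (n.invertible_of_three_cycle hij hik hjk w wi wj wk h) (by omega) (by omega) (by omega)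
    (by omega) (by omega) (by omega) (by omega)

/-- Either some pair is at least as heavy as both triples, or the heavier triple, strictly heavier
than its reverse, outweighs all pairs. -/
lemma TINOptimal.hasOptimalBackoff {n : ADTSubchannel 3} (hn : n.TINOptimal)
    (h : n 0 1 + n 1 2 + n 2 0 ≠ n 1 0 + n 2 1 + n 0 2) : n.HasOptimalBackoff := by
  have c01 := hn.hasOptimalBackoff_of_two_cycle (i := 0) (j := 1) (k := 2) (by decide) (by decide)
    (by decide)
  have c02 := hn.hasOptimalBackoff_of_two_cycle (i := 0) (j := 2) (k := 1) (by decide) (by decide)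
    (by decide)
  have c12 := hn.hasOptimalBackoff_of_two_cycle (i := 1) (j := 2) (k := 0) (by decide) (by decide)
    (by decide)
  have c012 := hn.hasOptimalBackoff_of_three_cycle (i := 0) (j := 1) (k := 2) (by decide)
    (by decide) (by decide)
  have c021 := hn.hasOptimalBackoff_of_three_cycle (i := 0) (j := 2) (k := 1) (by decide)
    (by decide) (by decide)
  by_contra hC
  simp only [hC, imp_false] at c01 c02 c12 c012 c021
  omega

end ADTSubchannel

theorem theorem6 (M : ℕ) (n : ADTNetwork 3 M)
    (hTIN : ∀ m, (n m).TINOptimal)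
    (hn : ∀ m, n m 0 1 + n m 1 2 + n m 2 0 ≠ n m 1 0 + n m 2 1 + n m 0 2) :
    ∃ r : Fin M → Fin 3 → ℕ,
      (∀ m, (n m).tinRate (r m) ∈ (n.single m).capacityRegion) ∧
      n.separateTINRate r ∈ n.capacityRegion ∧
      n.IsSumCapacity (∑ k, n.separateTINRate r k) := by
  choose r w hw hinv hr hsum using fun m => (hTIN m).hasOptimalBackoff (hn m)
  have hmem := n.separateTINRate_mem_capacityRegion hTIN r hr
  refine ⟨r, fun m => ?_, hmem, ⟨_, hmem, rfl⟩, ?_⟩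
  · have h := (n.single m).separateTINRate_mem_capacityRegion (fun _ => hTIN m) (fun _ => r m)
      (fun _ => hr m)
    have he : (n.single m).separateTINRate (fun _ => r m) = (n m).tinRate (r m) := by
      funext k
      simp [ADTNetwork.separateTINRate, ADTNetwork.single]
    rwa [he] at h
  · have hS : ∑ k, n.separateTINRate r k = ∑ k, ∑ m, ((n m k k - w m k : ℕ) : ℝ) := by
      simp only [ADTNetwork.separateTINRate]
      rw [Finset.sum_comm, Finset.sum_comm (f := fun k m => ((n m k k - w m k : ℕ) : ℝ))]
      refine Finset.sum_congr rfl fun m _ => ?_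
      have hrate : ∀ k, (n m).tinRate (r m) k
          = ((n m k k - r m k - (n m).noiseFloor (r m) k : ℕ) : ℝ) := fun k =>
        (n m).tinRate_eq _ _ (fun i => by
          rw [(hTIN m).depth_eq i]
          exact (Nat.le_add_right _ _).trans (hr m i)) ((hTIN m).depth_eq k) (hr m k)
      have h := hsum m
      have hle := hr m
      have hwle := fun k => (hw m k).trans ((hTIN m).crossDepth_le k)
      rw [Fin.sum_univ_three, Fin.sum_univ_three] at h
      rw [Fin.sum_univ_three, Fin.sum_univ_three, hrate, hrate, hrate]
      norm_cast
      have := hle 0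
      have := hle 1
      have := hle 2
      have := hwle 0
      have := hwle 1
      have := hwle 2
      omega
    rintro _ ⟨R, hR, rfl⟩
    -- The bound on achievable tuples is a closed condition and so passes to the capacity region.
    have hclosed : IsClosed {R : Fin 3 → ℝ | ∑ k, R k ≤ ∑ k, n.separateTINRate r k} :=
      isClosed_le (by fun_prop) continuous_const
    refine closure_minimal (fun R hR => ?_) hclosed hR
    rw [Set.mem_ofPred_eq, hS]
    exact n.sum_le_of_achievable hTIN w hw hinv hR
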